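/- For integers $n\ge 0$, $p\ge 1$ let $$S_n^p=\frac{(-1)^n}{n!}\sum_{k=0}^{n}\frac{(-1)^k\binom{n}{k}}{(k+1)^p}$$ be the generalized Stirling numbers of the second kind, and let $s(n,k)$ be the (signed) Stirling numbers of the first kind, defined by $$\frac{\log^k(1+t)}{k!}=\sum_{n=k}^{\infty}s(n,k)\frac{t^n}{n!},\qquad |t|<1,\ k=0,1,2,\dots$$ For integers $p\ge 2$ and $N\ge p$ define the rational number $$\zeta_N(p)=\sum_{n=0}^{4N}\frac{S_n^p}{n+1}N^{n+1}+\sum_{n=0}^{N-p}\frac{(-1)^n s(n+p-1,p-1)}{(n+p-1)\,N^{n+p-1}}.$$ Let $\zeta$ be the Riemann zeta function. Then for every integer $p\ge 2$ there exist a constant $C>0$ (depending on $p$) and an integer $N_0\ge p$ such that for all integers $N\ge N_0$ $$|\zeta(p)-\zeta_N(p)|\le C\,N\,e^{-N}.$$ -/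

import Mathlib

namespace ZetaApprox

/-- The (signed) Stirling number of the first kind `s(n, k)`, defined by the generating function
`log(1 + t)^k / k! = ∑ₙ s(n, k) tⁿ / n!`.  Mathlib's `PowerSeries.log ℚ` is the power series of
`log(1 + X)`. -/
noncomputable def stirlingS (n k : ℕ) : ℚ :=
  (n.factorial : ℚ) * PowerSeries.coeff n ((PowerSeries.log ℚ) ^ k) / (k.factorial : ℚ)

/-- The generalized Stirling number of the second kind
`S_n^p = (-1)^n / n! * ∑_{k=0}^{n} (-1)^k * (n choose k) / (k+1)^p`. -/
def genStirling (p n : ℕ) : ℚ :=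
  (-1) ^ n / (n.factorial : ℚ) *
    ∑ k ∈ Finset.range (n + 1), (-1) ^ k * (n.choose k : ℚ) / ((k : ℚ) + 1) ^ p

/-- The rational approximation `ζ_N(p)`, for integers `N ≥ p ≥ 2`:
the first sum runs over `0 ≤ n ≤ 4N` and the second one over `0 ≤ n ≤ N - p`. -/
noncomputable def zetaApprox (p N : ℕ) : ℚ :=
  (∑ n ∈ Finset.range (4 * N + 1), genStirling p n * (N : ℚ) ^ (n + 1) / ((n : ℚ) + 1)) +
    ∑ n ∈ Finset.range (N + 1 - p),
      (-1) ^ n * stirlingS (n + p - 1) (p - 1) /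
        (((n + p - 1 : ℕ) : ℚ) * (N : ℚ) ^ (n + p - 1))

theorem stirlingS_succ_succ (n k : ℕ) :
    stirlingS (n + 1) (k + 1) = stirlingS n k - n * stirlingS n (k + 1) := by
  have h1 : (1 + PowerSeries.X) * PowerSeries.derivative ℚ (PowerSeries.log ℚ) = 1 := by
    rw [PowerSeries.deriv_log]
    ext m
    rcases m with _ | m
    · simp [add_mul]
    · simp [add_mul, PowerSeries.coeff_succ_X_mul, PowerSeries.coeff_one, pow_succ]
  have h2 : (1 + PowerSeries.X) * PowerSeries.derivative ℚ ((PowerSeries.log ℚ) ^ (k + 1))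
      = PowerSeries.C ((k : ℚ) + 1) * (PowerSeries.log ℚ) ^ k := by
    rw [Derivation.leibniz_pow]
    simp only [Nat.add_sub_cancel, smul_eq_mul, nsmul_eq_mul, map_add, map_natCast, map_one]
    push_cast
    linear_combination ((k : PowerSeries ℚ) + 1) * (PowerSeries.log ℚ) ^ k * h1
  have h3 : PowerSeries.coeff (n + 1) ((PowerSeries.log ℚ) ^ (k + 1)) * ((n : ℚ) + 1)
      + n * PowerSeries.coeff n ((PowerSeries.log ℚ) ^ (k + 1))
      = ((k : ℚ) + 1) * PowerSeries.coeff n ((PowerSeries.log ℚ) ^ k) := by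
    have h := congrArg (PowerSeries.coeff n) h2
    rw [PowerSeries.coeff_C_mul] at h
    rw [← h, add_mul, one_mul, map_add, PowerSeries.coeff_derivative]
    rcases n with _ | n
    · simp
    · rw [PowerSeries.coeff_succ_X_mul, PowerSeries.coeff_derivative]
      push_cast
      ring
  have hk : (k.factorial : ℚ) ≠ 0 := by exact_mod_cast k.factorial_ne_zero
  have hk1 : (k : ℚ) + 1 ≠ 0 := by positivity
  unfold stirlingS
  rw [Nat.factorial_succ, Nat.factorial_succ]
  push_cast
  field_simp
  linear_combination h3

/-- Comparison with Mathlib's unsigned Stirling numbers of the first kind. -/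
theorem stirlingS_eq (n k : ℕ) :
    stirlingS n k = (-1) ^ (n + k) * (Nat.stirlingFirst n k : ℚ) := by
  induction n generalizing k with
  | zero =>
    rcases k with _ | k
    · simp [stirlingS]
    · simp [stirlingS]
  | succ n ih =>
    rcases k with _ | k
    · simp [stirlingS, PowerSeries.coeff_one]
    · rw [stirlingS_succ_succ, ih, ih, Nat.stirlingFirst_succ_succ]
      push_cast
      ring

end ZetaApprox

namespace ZetaApprox

open Filter Topology

/-! Write `p = q + 2` and let `c m` be the coefficient of `v ^ m` in `(-log (1 - v)) ^ (q + 1) / (q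
+ 1)!`. Integrating this series against `(1 - v) ^ n / v` and summing gives `ζ(p) = ∑ c (m + 1) / (m
+ 1)`, where `1 / (m + 1) = ∫ v in 0..1, v ^ m` (`hasSum_logPowCoeff_div`). Split `1 = (1 - exp (-N
v)) + exp (-N v)` under that integral. Truncating the Taylor series of the first part yields the
`genStirling` sum; replacing the second by the complete Gamma integral `m! / N ^ (m + 1)` for `m + 1
< N`, and by `0` otherwise, yields the `stirlingS` sum. Each replacement costs `O(N exp (-N) / (m +
1))` (`abs_error_coeff_le`). As `c ≥ 0`, weighting by `c (m + 1)` and summing gives `3 ζ(p) N exp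
(-N)`. -/

/-- The coefficients of `(-log (1 - v)) ^ q / q!`. -/
noncomputable def logPowCoeff (q m : ℕ) : ℝ :=
  (Nat.stirlingFirst m q : ℝ) / (m.factorial : ℝ)

/-- The Beta integral `∫ v in 0..1, v ^ m * (1 - v) ^ n = m! n! / (m + n + 1)!`. -/
noncomputable def betaNat (m n : ℕ) : ℝ :=
  (m.factorial : ℝ) * (n.factorial : ℝ) / ((m + n + 1).factorial : ℝ)

/-! ### Recurrences for the logarithmic coefficients and the Beta integrals. -/

theorem logPowCoeff_nonneg (q m : ℕ) : 0 ≤ logPowCoeff q m := by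
  unfold logPowCoeff; positivity

theorem logPowCoeff_succ_zero (q : ℕ) : logPowCoeff (q + 1) 0 = 0 := by
  simp [logPowCoeff]

theorem logPowCoeff_zero_succ (m : ℕ) : logPowCoeff 0 (m + 1) = 0 := by
  simp [logPowCoeff]

theorem logPowCoeff_zero_zero : logPowCoeff 0 0 = 1 := by
  simp [logPowCoeff]

theorem logPowCoeff_of_lt {q m : ℕ} (h : m < q) : logPowCoeff q m = 0 := by
  simp [logPowCoeff, Nat.stirlingFirst_eq_zero_of_lt h]

theorem succ_mul_logPowCoeff (q m : ℕ) :
    ((m : ℝ) + 1) * logPowCoeff (q + 1) (m + 1) =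
      m * logPowCoeff (q + 1) m + logPowCoeff q m := by
  have h : (m.factorial : ℝ) ≠ 0 := by exact_mod_cast m.factorial_ne_zero
  simp only [logPowCoeff, Nat.stirlingFirst_succ_succ, Nat.factorial_succ]
  push_cast
  field_simp

theorem mul_logPowCoeff_eq_sum (q m : ℕ) :
    (m : ℝ) * logPowCoeff (q + 1) m = ∑ j ∈ Finset.range m, logPowCoeff q j := by
  induction m with
  | zero => simp
  | succ m ih =>
    rw [Finset.sum_range_succ, ← ih, ← succ_mul_logPowCoeff]
    push_cast
    ring

/-- Each coefficient sequence consists of the Cesàro means of the preceding one. -/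
theorem tendsto_logPowCoeff (q : ℕ) : Tendsto (logPowCoeff q) atTop (𝓝 0) := by
  induction q with
  | zero =>
    refine tendsto_const_nhds.congr' ?_
    filter_upwards [eventually_ge_atTop 1] with m hm
    obtain ⟨k, rfl⟩ := Nat.exists_eq_add_of_le' hm
    exact (logPowCoeff_zero_succ k).symm
  | succ q ih =>
    refine ih.cesaro.congr' ?_
    filter_upwards [eventually_ge_atTop 1] with m hm
    have : (m : ℝ) ≠ 0 := by positivity
    rw [← mul_logPowCoeff_eq_sum]
    field_simp

theorem betaNat_nonneg (m n : ℕ) : 0 ≤ betaNat m n := by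
  unfold betaNat; positivity

theorem betaNat_zero_left (n : ℕ) : betaNat 0 n = 1 / ((n : ℝ) + 1) := by
  have h : (n.factorial : ℝ) ≠ 0 := by exact_mod_cast n.factorial_ne_zero
  simp only [betaNat, zero_add, Nat.factorial_succ, Nat.factorial_zero]
  push_cast
  field_simp

theorem betaNat_zero_right (m : ℕ) : betaNat m 0 = 1 / ((m : ℝ) + 1) := by
  have h : (m.factorial : ℝ) ≠ 0 := by exact_mod_cast m.factorial_ne_zero
  simp only [betaNat, add_zero, Nat.factorial_succ, Nat.factorial_zero]
  push_cast
  field_simp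

theorem succ_mul_betaNat_sub (m n : ℕ) :
    ((m : ℝ) + 1) * (betaNat m n - betaNat (m + 1) n) = (n + 1) * betaNat (m + 1) n := by
  have h : ((m + n + 1).factorial : ℝ) ≠ 0 := by exact_mod_cast Nat.factorial_ne_zero _
  simp only [betaNat, show m + 1 + n + 1 = (m + n + 1) + 1 by ring, Nat.factorial_succ (m + n + 1),
    Nat.factorial_succ m]
  push_cast
  field_simp
  ring

theorem betaNat_sub_succ_right (m n : ℕ) :
    betaNat m (n + 1) - betaNat m n = -betaNat (m + 1) n := by
  have h : ((m + n + 1).factorial : ℝ) ≠ 0 := by exact_mod_cast Nat.factorial_ne_zero _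
  simp only [betaNat, show m + 1 + n + 1 = (m + n + 1) + 1 by ring,
    show m + (n + 1) + 1 = (m + n + 1) + 1 by ring, Nat.factorial_succ (m + n + 1),
    Nat.factorial_succ m, Nat.factorial_succ n]
  push_cast
  field_simp
  ring

/-- Expand `v ^ n = (1 - (1 - v)) ^ n` under the integral; here as an `n`-th forward difference,
each difference multiplying the integrand by `-v`. -/
theorem sum_alternating_choose_mul_betaNat (m n : ℕ) :
    ∑ k ∈ Finset.range (n + 1), (-1) ^ k * (n.choose k : ℝ) * betaNat m k =
      1 / ((m : ℝ) + n + 1) := by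
  have h (n y : ℕ) : (fwdDiff 1)^[n] (betaNat m) y = (-1) ^ n * betaNat (m + n) y := by
    induction n generalizing y with
    | zero => simp
    | succ n ih =>
      rw [Function.iterate_succ_apply', fwdDiff, ih, ih, ← mul_sub, betaNat_sub_succ_right]
      rw [pow_succ, add_assoc]
      ring
  have h0 := h n 0
  rw [fwdDiff_iter_eq_sum_shift, betaNat_zero_right] at h0
  have h1 : ((-1 : ℝ) ^ n) * (-1) ^ n = 1 := by
    rw [← mul_pow]; simp
  calc
    _ = (-1) ^ n * ∑ k ∈ Finset.range (n + 1),
          ((-1 : ℤ) ^ (n - k) * n.choose k) • betaNat m (0 + k • 1) := by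
      rw [Finset.mul_sum]
      refine Finset.sum_congr rfl fun k hk => ?_
      have hk : k ≤ n := Nat.lt_succ_iff.mp (Finset.mem_range.mp hk)
      obtain ⟨j, rfl⟩ := Nat.exists_eq_add_of_le hk
      have h2 : ((-1 : ℝ) ^ j) * (-1) ^ j = 1 := by
        rw [← mul_pow]; simp
      simp only [Nat.add_sub_cancel_left, zero_add, smul_eq_mul, mul_one, zsmul_eq_mul]
      push_cast
      rw [pow_add]
      linear_combination (-((-1 : ℝ) ^ k * ((k + j).choose k : ℝ) * betaNat m k)) * h2
    _ = _ := by
      rw [h0, ← mul_assoc, h1]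
      push_cast
      ring

theorem mul_betaNat_le_one (m n : ℕ) : (m : ℝ) * betaNat m n ≤ 1 := by
  have anti : betaNat m n ≤ betaNat m 0 := by
    refine antitone_nat_of_succ_le (f := betaNat m) (fun n => ?_) (Nat.zero_le n)
    linarith [betaNat_sub_succ_right m n, betaNat_nonneg (m + 1) n]
  rw [betaNat_zero_right] at anti
  calc (m : ℝ) * betaNat m n ≤ m * (1 / ((m : ℝ) + 1)) := by gcongr
    _ ≤ 1 := by
      rw [mul_one_div, div_le_one (by positivity)]
      linarith

/-! ### Series for `1 / (n + 1) ^ (q + 1)` and for the zeta value. -/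

/-- Summation by parts, lowering the power of the logarithm; the boundary term vanishes as `M → ∞`.
-/
theorem sum_logPowCoeff_mul_betaNat (q n M : ℕ) :
    ((n : ℝ) + 1) * ∑ m ∈ Finset.range (M + 1), logPowCoeff (q + 1) m * betaNat m n =
      ∑ m ∈ Finset.range M, logPowCoeff q m * betaNat m n
        - M * logPowCoeff (q + 1) M * betaNat M n := by
  induction M with
  | zero => simp [logPowCoeff_succ_zero]
  | succ M ih =>
    rw [Finset.sum_range_succ, mul_add, ih, Finset.sum_range_succ]
    push_cast
    linear_combination (-logPowCoeff (q + 1) (M + 1)) * succ_mul_betaNat_sub M n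
      + betaNat M n * succ_mul_logPowCoeff q M

theorem hasSum_logPowCoeff_mul_betaNat (q n : ℕ) :
    HasSum (fun m => logPowCoeff q m * betaNat m n) (1 / ((n : ℝ) + 1) ^ (q + 1)) := by
  induction q with
  | zero =>
    have := hasSum_single (f := fun m => logPowCoeff 0 m * betaNat m n) 0 (by
      intro m hm
      obtain ⟨k, rfl⟩ := Nat.exists_eq_succ_of_ne_zero hm
      simp [logPowCoeff_zero_succ])
    simpa [logPowCoeff_zero_zero, betaNat_zero_left] using this
  | succ q ih =>
    rw [hasSum_iff_tendsto_nat_of_nonneg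
      fun m => mul_nonneg (logPowCoeff_nonneg _ _) (betaNat_nonneg _ _)]
    have hn : (n : ℝ) + 1 ≠ 0 := by positivity
    have hrem : Tendsto (fun M : ℕ => M * logPowCoeff (q + 1) M * betaNat M n) atTop (𝓝 0) := by
      refine squeeze_zero (fun M => ?_) (fun M => ?_) (tendsto_logPowCoeff (q + 1))
      · have := logPowCoeff_nonneg (q + 1) M
        have := betaNat_nonneg M n
        positivity
      · have := mul_le_mul_of_nonneg_left (mul_betaNat_le_one M n) (logPowCoeff_nonneg (q + 1) M)
        linarith
    have h := ((ih.tendsto_sum_nat.sub hrem).const_mul ((n : ℝ) + 1)⁻¹)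
    rw [← tendsto_add_atTop_iff_nat 1]
    have e : ((n : ℝ) + 1)⁻¹ * (1 / ((n : ℝ) + 1) ^ (q + 1) - 0)
        = 1 / ((n : ℝ) + 1) ^ (q + 1 + 1) := by
      rw [sub_zero, pow_succ _ (q + 1)]
      field_simp
    rw [e] at h
    refine h.congr fun M => ?_
    rw [← sum_logPowCoeff_mul_betaNat]
    field_simp

theorem hasSum_betaNat_succ (m : ℕ) :
    HasSum (fun n => betaNat (m + 1) n) (1 / ((m : ℝ) + 1)) := by
  rw [hasSum_iff_tendsto_nat_of_nonneg fun n => betaNat_nonneg _ _]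
  have hs (M : ℕ) : ∑ n ∈ Finset.range M, betaNat (m + 1) n = betaNat m 0 - betaNat m M := by
    induction M with
    | zero => simp
    | succ M ih =>
      rw [Finset.sum_range_succ, ih]
      linarith [betaNat_sub_succ_right m M]
  simp only [hs, betaNat_zero_right]
  have h0 : Tendsto (fun M => betaNat m M) atTop (𝓝 0) := by
    refine squeeze_zero (fun M => betaNat_nonneg _ _) (fun M => ?_)
      tendsto_one_div_add_atTop_nhds_zero_nat
    rw [← betaNat_zero_left]
    refine antitone_nat_of_succ_le (f := fun m => betaNat m M) (fun m => ?_) (Nat.zero_le m)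
    linarith [betaNat_sub_succ_right m M, betaNat_nonneg m (M + 1)]
  simpa using tendsto_const_nhds.sub h0

/-- Tonelli for a nonnegative double series: summing over `m` first gives the zeta terms, over `n`
first the left side. -/
theorem hasSum_logPowCoeff_div (q : ℕ) :
    HasSum (fun m : ℕ => logPowCoeff (q + 1) (m + 1) / ((m : ℝ) + 1))
      (∑' n : ℕ, 1 / ((n : ℝ) + 1) ^ (q + 2)) := by
  have hrow (n : ℕ) : HasSum (fun m => logPowCoeff (q + 1) (m + 1) * betaNat (m + 1) n)
      (1 / ((n : ℝ) + 1) ^ (q + 2)) := by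
    have := hasSum_logPowCoeff_mul_betaNat (q + 1) n
    rw [← hasSum_nat_add_iff' 1] at this
    simpa [logPowCoeff_succ_zero] using this
  have hcol (m : ℕ) : HasSum (fun n => logPowCoeff (q + 1) (m + 1) * betaNat (m + 1) n)
      (logPowCoeff (q + 1) (m + 1) / ((m : ℝ) + 1)) := by
    simpa [div_eq_mul_inv] using (hasSum_betaNat_succ m).mul_left (logPowCoeff (q + 1) (m + 1))
  have hz : Summable fun n : ℕ => 1 / ((n : ℝ) + 1) ^ (q + 2) := by
    have := (summable_nat_add_iff 1).mpr (Real.summable_one_div_nat_pow.mpr (by omega : 1 < q + 2))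
    simpa using this
  have hsum : Summable fun x : ℕ × ℕ =>
      logPowCoeff (q + 1) (x.2 + 1) * betaNat (x.2 + 1) x.1 := by
    rw [summable_prod_of_nonneg
      fun x => mul_nonneg (logPowCoeff_nonneg _ _) (betaNat_nonneg _ _)]
    exact ⟨fun n => (hrow n).summable, by simpa only [(hrow _).tsum_eq] using hz⟩
  have h1 := hsum.hasSum.prod_fiberwise hrow
  rw [h1.tsum_eq]
  have h2 := (Equiv.prodComm ℕ ℕ).hasSum_iff.mpr hsum.hasSum
  exact h2.prod_fiberwise hcol

theorem hasSum_logPowCoeff_div_add (q n : ℕ) :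
    HasSum (fun m : ℕ => logPowCoeff q m / ((m : ℝ) + n + 1))
      (∑ k ∈ Finset.range (n + 1), (-1) ^ k * (n.choose k : ℝ) / ((k : ℝ) + 1) ^ (q + 1)) := by
  have h := hasSum_sum (s := Finset.range (n + 1)) fun k _ =>
    (hasSum_logPowCoeff_mul_betaNat q k).mul_left ((-1) ^ k * (n.choose k : ℝ))
  simp only [mul_one_div] at h
  refine h.congr_fun fun m => ?_
  rw [div_eq_mul_one_div, ← sum_alternating_choose_mul_betaNat, Finset.mul_sum]
  exact Finset.sum_congr rfl fun k _ => by ring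

/-! ### Incomplete Gamma integrals. -/

/-- The incomplete Gamma integral `∫ v in 0..1, v ^ m * exp (-x v)`. -/
noncomputable def expMoment (x : ℝ) (m : ℕ) : ℝ :=
  ∫ v in (0 : ℝ)..1, v ^ m * Real.exp (-(x * v))

theorem expMoment_nonneg (x : ℝ) (m : ℕ) : 0 ≤ expMoment x m :=
  intervalIntegral.integral_nonneg zero_le_one fun _ hv =>
    mul_nonneg (pow_nonneg hv.1 _) (Real.exp_pos _).le

theorem expMoment_succ_le (x : ℝ) (m : ℕ) : expMoment x (m + 1) ≤ expMoment x m := by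
  refine intervalIntegral.integral_mono_on zero_le_one
    (Continuous.intervalIntegrable (by fun_prop) _ _)
    (Continuous.intervalIntegrable (by fun_prop) _ _) fun v hv => ?_
  exact mul_le_mul_of_nonneg_right (pow_le_pow_of_le_one hv.1 hv.2 m.le_succ) (Real.exp_pos _).le

theorem mul_expMoment_zero (x : ℝ) : x * expMoment x 0 = 1 - Real.exp (-x) := by
  have h : ∀ v ∈ Set.uIcc (0 : ℝ) 1, HasDerivAt (fun y => -Real.exp (-(x * y)))
      (x * (v ^ 0 * Real.exp (-(x * v)))) v := fun v _ => by
    have := (((hasDerivAt_id v).const_mul x).neg.exp).neg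
    exact this.congr_deriv (by simp; ring)
  rw [expMoment, ← intervalIntegral.integral_const_mul,
    intervalIntegral.integral_eq_sub_of_hasDerivAt h
      (Continuous.intervalIntegrable (by fun_prop) _ _)]
  simp
  ring

theorem mul_expMoment_succ (x : ℝ) (m : ℕ) :
    x * expMoment x (m + 1) = (m + 1) * expMoment x m - Real.exp (-x) := by
  have h : ∀ v ∈ Set.uIcc (0 : ℝ) 1, HasDerivAt (fun v => v ^ (m + 1) * Real.exp (-(x * v)))
      ((m + 1) * (v ^ m * Real.exp (-(x * v))) - x * (v ^ (m + 1) * Real.exp (-(x * v)))) v :=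
    fun v _ => by
      have := (hasDerivAt_pow (m + 1) v).mul (((hasDerivAt_id v).const_mul x).neg.exp)
      exact this.congr_deriv (by simp; ring)
  have key := intervalIntegral.integral_eq_sub_of_hasDerivAt h
    (Continuous.intervalIntegrable (by fun_prop) _ _)
  rw [intervalIntegral.integral_sub (Continuous.intervalIntegrable (by fun_prop) _ _)
    (Continuous.intervalIntegrable (by fun_prop) _ _), intervalIntegral.integral_const_mul,
    intervalIntegral.integral_const_mul] at key
  simp only [← expMoment.eq_1] at key
  simp at key
  linarith

/-- The difference is the tail over `v > 1`. Integration by parts sends `D` to `((m + 1) D + exp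
(-N)) / N`, which preserves the interval while `m + 2 ≤ N`. -/
theorem factorial_div_pow_sub_expMoment_mem {N : ℕ} (m : ℕ) (hm : m < N) :
    (m.factorial : ℝ) / (N : ℝ) ^ (m + 1) - expMoment N m ∈
      Set.Icc 0 (Real.exp (-(N : ℝ))) := by
  have hN : (0 : ℝ) < N := by exact_mod_cast (Nat.zero_le m).trans_lt hm
  have hN1 : (1 : ℝ) ≤ N := by exact_mod_cast hN
  have he := Real.exp_pos (-(N : ℝ))
  induction m with
  | zero =>
    have h := mul_expMoment_zero N
    have e : expMoment N 0 = (1 - Real.exp (-(N : ℝ))) / N := by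
      rw [eq_div_iff hN.ne']; linarith
    have e' : ((Nat.factorial 0 : ℕ) : ℝ) / (N : ℝ) ^ (0 + 1) - expMoment N 0
        = Real.exp (-(N : ℝ)) / N := by
      rw [e]; simp; ring
    rw [e']
    exact ⟨by positivity, div_le_self he.le hN1⟩
  | succ m ih =>
    obtain ⟨h0, h1⟩ := ih (by omega)
    have hmN : (m : ℝ) + 1 + 1 ≤ N := by exact_mod_cast hm
    have h := mul_expMoment_succ N m
    set D := (m.factorial : ℝ) / (N : ℝ) ^ (m + 1) - expMoment N m
    have e : (((m + 1).factorial : ℕ) : ℝ) / (N : ℝ) ^ (m + 1 + 1) - expMoment N (m + 1)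
        = (((m : ℝ) + 1) * D + Real.exp (-(N : ℝ))) / N := by
      rw [eq_div_iff hN.ne']
      have e1 : (((m + 1).factorial : ℕ) : ℝ) / (N : ℝ) ^ (m + 1 + 1) * N
          = (m + 1) * ((m.factorial : ℝ) / (N : ℝ) ^ (m + 1)) := by
        rw [Nat.factorial_succ, pow_succ _ (m + 1)]
        push_cast
        field_simp
      rw [sub_mul, e1]
      simp only [D]
      linarith
    rw [e]
    refine ⟨by positivity, ?_⟩
    rw [div_le_iff₀ hN]
    nlinarith

theorem expMoment_le {N : ℕ} (hN0 : 0 < N) (m : ℕ) (hm : N ≤ m + 1) :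
    expMoment N m ≤ 2 * N * Real.exp (-(N : ℝ)) / ((m : ℝ) + 1) := by
  have hN : (1 : ℝ) ≤ N := by exact_mod_cast hN0
  have he := Real.exp_pos (-(N : ℝ))
  have gt (m : ℕ) (hm : N < m + 1) : ((m : ℝ) + 1 - N) * expMoment N m ≤ Real.exp (-(N : ℝ)) := by
    have := mul_expMoment_succ N m
    have := mul_le_mul_of_nonneg_left (expMoment_succ_le N m) (by positivity : (0 : ℝ) ≤ N)
    linarith
  rw [le_div_iff₀ (by positivity)]
  rcases hm.lt_or_eq with h | h
  · have h1 : (N : ℝ) + 1 ≤ m + 1 := by exact_mod_cast h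
    have h2 := gt m h
    have h3 := expMoment_nonneg N m
    have h4 : (m : ℝ) + 1 ≤ 2 * N * (m + 1 - N) := by nlinarith
    have h5 := mul_le_mul_of_nonneg_left h4 h3
    have h6 := mul_le_mul_of_nonneg_left h2 (by positivity : (0 : ℝ) ≤ 2 * N)
    linarith
  -- Here the factor `m + 1 - N` in `gt` vanishes, so the bound is taken at `m + 1` and brought back
  -- by the recurrence.
  · have hc : (N : ℝ) = m + 1 := by exact_mod_cast h
    have h1 := gt (m + 1) (by omega)
    push_cast at h1
    rw [← hc] at h1 ⊢
    have h2 := mul_expMoment_succ N m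
    rw [← hc] at h2
    have h3 : expMoment N (m + 1) ≤ Real.exp (-(N : ℝ)) := by linarith
    have h4 := mul_le_mul_of_nonneg_left h3 (by positivity : (0 : ℝ) ≤ N)
    have h5 := mul_le_mul_of_nonneg_right hN he.le
    linarith

/-! ### Truncation of the exponential series and the error per coefficient. -/

theorem abs_exp_sub_sum_le (x : ℝ) (M : ℕ) :
    |Real.exp x - ∑ k ∈ Finset.range M, x ^ k / (k.factorial : ℝ)| ≤
      Real.exp (4 * |x|) / 4 ^ M := by
  have hx : HasSum (fun k : ℕ => x ^ k / (k.factorial : ℝ)) (Real.exp x) := by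
    rw [Real.exp_eq_exp_ℝ]; exact NormedSpace.expSeries_div_hasSum_exp x
  have h4 : HasSum (fun k : ℕ => (4 * |x|) ^ k / (k.factorial : ℝ)) (Real.exp (4 * |x|)) := by
    rw [Real.exp_eq_exp_ℝ]; exact NormedSpace.expSeries_div_hasSum_exp _
  rw [← ((hasSum_nat_add_iff' M).mpr hx).tsum_eq, ← Real.norm_eq_abs]
  have h5 := ((hasSum_nat_add_iff' M).mpr h4).div_const (4 ^ M)
  refine (tsum_of_norm_bounded h5 fun k => ?_).trans ?_
  · rw [norm_div, norm_pow, Real.norm_eq_abs, Real.norm_natCast, div_right_comm]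
    gcongr
    rw [le_div_iff₀ (by positivity), mul_pow, mul_comm]
    gcongr
    · norm_num
    · omega
  · gcongr
    have : 0 ≤ ∑ k ∈ Finset.range M, (4 * |x|) ^ k / (k.factorial : ℝ) :=
      Finset.sum_nonneg fun k _ => by positivity
    linarith

/-- This is where the cutoff `4N` suffices: `exp 5 ≤ 4 ^ 4`. -/
theorem exp_four_mul_div_pow_le (N : ℕ) :
    Real.exp (4 * (N : ℝ)) / 4 ^ (4 * N + 2) ≤ Real.exp (-(N : ℝ)) := by
  rw [div_le_iff₀ (by positivity)]
  have h : Real.exp 5 ≤ 4 ^ 4 := by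
    have := Real.exp_one_lt_d9.le
    calc Real.exp 5 = Real.exp 1 ^ 5 := by rw [← Real.exp_nat_mul]; norm_num
      _ ≤ 2.7182818286 ^ 5 := by gcongr
      _ ≤ 4 ^ 4 := by norm_num
  calc Real.exp (4 * (N : ℝ)) = Real.exp (-(N : ℝ)) * Real.exp 5 ^ N := by
        rw [← Real.exp_nat_mul, ← Real.exp_add]; ring_nf
    _ ≤ Real.exp (-(N : ℝ)) * (4 ^ 4) ^ N := by gcongr
    _ ≤ Real.exp (-(N : ℝ)) * 4 ^ (4 * N + 2) := by
      rw [← pow_mul]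
      gcongr
      · norm_num
      · omega

theorem abs_inv_sub_sum_sub_expMoment_le (N m : ℕ) :
    |1 / ((m : ℝ) + 1) - (∑ n ∈ Finset.range (4 * N + 1),
        (-1) ^ n * (N : ℝ) ^ (n + 1) / ((n + 1).factorial : ℝ) / ((m : ℝ) + 1 + n + 1))
          - expMoment N m| ≤ Real.exp (-(N : ℝ)) / ((m : ℝ) + 1) := by
  have hpow (k : ℕ) : ∫ v in (0 : ℝ)..1, v ^ k = 1 / ((k : ℝ) + 1) := by
    rw [integral_pow]; simp
  have e : 1 / ((m : ℝ) + 1) - (∑ n ∈ Finset.range (4 * N + 1),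
        (-1) ^ n * (N : ℝ) ^ (n + 1) / ((n + 1).factorial : ℝ) / ((m : ℝ) + 1 + n + 1))
      = ∫ v in (0 : ℝ)..1, v ^ m *
          ∑ k ∈ Finset.range (4 * N + 2), (-(N * v)) ^ k / (k.factorial : ℝ) := by
    have hterm (k : ℕ) : ∫ v in (0 : ℝ)..1, v ^ m * ((-(N * v)) ^ k / (k.factorial : ℝ)) =
        (-(N : ℝ)) ^ k / (k.factorial : ℝ) * (1 / (((m + k : ℕ) : ℝ) + 1)) := by
      rw [← hpow, ← intervalIntegral.integral_const_mul]
      congr 1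
      ext v
      rw [pow_add, neg_mul_eq_neg_mul, mul_pow]
      ring
    simp only [Finset.mul_sum]
    rw [intervalIntegral.integral_finsetSum fun k _ =>
      Continuous.intervalIntegrable (by fun_prop) _ _]
    simp only [hterm]
    -- The Taylor term `k = 0` is `1 / (m + 1)`; the terms `k = n + 1` form the subtracted sum.
    rw [Finset.sum_range_succ' _ (4 * N + 1), add_comm (Finset.sum _ _), sub_eq_add_neg, ← Finset.sum_neg_distrib]
    congr 1
    · simp
    · refine Finset.sum_congr rfl fun n _ => ?_
      rw [neg_pow (N : ℝ)]
      push_cast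
      ring
  rw [e, expMoment, ← intervalIntegral.integral_sub
    (Continuous.intervalIntegrable (by fun_prop) _ _)
    (Continuous.intervalIntegrable (by fun_prop) _ _), ← Real.norm_eq_abs]
  have hbound : ∫ v in (0 : ℝ)..1, v ^ m * Real.exp (-(N : ℝ))
      = Real.exp (-(N : ℝ)) / ((m : ℝ) + 1) := by
    rw [intervalIntegral.integral_mul_const, hpow]; ring
  rw [← hbound]
  refine intervalIntegral.norm_integral_le_of_norm_le zero_le_one ?_
    (Continuous.intervalIntegrable (by fun_prop) _ _)
  refine Eventually.of_forall fun v hv => ?_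
  rw [← mul_sub, norm_mul, norm_pow, Real.norm_eq_abs, abs_of_pos hv.1, Real.norm_eq_abs,
    abs_sub_comm]
  refine mul_le_mul_of_nonneg_left ?_ (pow_nonneg hv.1.le _)
  refine (abs_exp_sub_sum_le _ _).trans (le_trans ?_ (exp_four_mul_div_pow_le N))
  gcongr
  rw [abs_neg, abs_of_nonneg (mul_nonneg N.cast_nonneg hv.1.le)]
  exact mul_le_of_le_one_right N.cast_nonneg hv.2

theorem abs_error_coeff_le {N : ℕ} (hN : 0 < N) (m : ℕ) :
    |1 / ((m : ℝ) + 1) - (∑ n ∈ Finset.range (4 * N + 1),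
        (-1) ^ n * (N : ℝ) ^ (n + 1) / ((n + 1).factorial : ℝ) / ((m : ℝ) + 1 + n + 1))
          - (if m + 1 < N then (m.factorial : ℝ) / (N : ℝ) ^ (m + 1) else 0)| ≤
      3 * N * Real.exp (-(N : ℝ)) / ((m : ℝ) + 1) := by
  have he := Real.exp_pos (-(N : ℝ))
  have hN1 : (1 : ℝ) ≤ N := by exact_mod_cast hN
  have h1 := abs_inv_sub_sum_sub_expMoment_le N m
  have h2 : |expMoment N m - (if m + 1 < N then (m.factorial : ℝ) / (N : ℝ) ^ (m + 1) else 0)| ≤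
      2 * N * Real.exp (-(N : ℝ)) / ((m : ℝ) + 1) := by
    split_ifs with h
    · obtain ⟨h0, h1⟩ := factorial_div_pow_sub_expMoment_mem (N := N) m (by omega)
      rw [abs_sub_comm, abs_of_nonneg h0]
      refine h1.trans ?_
      rw [le_div_iff₀ (by positivity)]
      have : (m : ℝ) + 1 + 1 ≤ N := by exact_mod_cast h
      nlinarith
    · rw [sub_zero, abs_of_nonneg (expMoment_nonneg _ _)]
      exact expMoment_le hN m (by omega)
  have h3 : Real.exp (-(N : ℝ)) / ((m : ℝ) + 1) ≤ N * Real.exp (-(N : ℝ)) / ((m : ℝ) + 1) := by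
    gcongr
    exact le_mul_of_one_le_left he.le hN1
  calc _ ≤ _ + _ := (abs_sub_le _ (expMoment N m) _).trans' (le_of_eq ?_)
    _ ≤ Real.exp (-(N : ℝ)) / ((m : ℝ) + 1) + 2 * N * Real.exp (-(N : ℝ)) / ((m : ℝ) + 1) :=
      add_le_add h1 h2
    _ ≤ N * Real.exp (-(N : ℝ)) / ((m : ℝ) + 1) + 2 * N * Real.exp (-(N : ℝ)) / ((m : ℝ) + 1) := by
      gcongr
    _ = _ := by ring
  rfl

/-! ### Identification of the two rational sums, and conclusion. -/

theorem hasSum_genStirling_part (q N : ℕ) :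
    HasSum (fun m : ℕ => logPowCoeff (q + 1) (m + 1) * ∑ n ∈ Finset.range (4 * N + 1),
        (-1) ^ n * (N : ℝ) ^ (n + 1) / ((n + 1).factorial : ℝ) / ((m : ℝ) + 1 + n + 1))
      (((∑ n ∈ Finset.range (4 * N + 1),
        genStirling (q + 2) n * (N : ℚ) ^ (n + 1) / ((n : ℚ) + 1) : ℚ)) : ℝ) := by
  have hrow (n : ℕ) : HasSum (fun m : ℕ => logPowCoeff (q + 1) (m + 1) / ((m : ℝ) + 1 + n + 1))
      (∑ k ∈ Finset.range (n + 1), (-1) ^ k * (n.choose k : ℝ) / ((k : ℝ) + 1) ^ (q + 2)) := by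
    have := hasSum_logPowCoeff_div_add (q + 1) n
    rw [← hasSum_nat_add_iff' 1] at this
    simpa [logPowCoeff_succ_zero] using this
  have h := hasSum_sum (s := Finset.range (4 * N + 1)) fun n _ =>
    (hrow n).mul_left ((-1) ^ n * (N : ℝ) ^ (n + 1) / ((n + 1).factorial : ℝ))
  have e : ((∑ n ∈ Finset.range (4 * N + 1),
      genStirling (q + 2) n * (N : ℚ) ^ (n + 1) / ((n : ℚ) + 1) : ℚ) : ℝ) =
      ∑ n ∈ Finset.range (4 * N + 1), (-1) ^ n * (N : ℝ) ^ (n + 1) / ((n + 1).factorial : ℝ) *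
        ∑ k ∈ Finset.range (n + 1), (-1) ^ k * (n.choose k : ℝ) / ((k : ℝ) + 1) ^ (q + 2) := by
    push_cast [genStirling]
    refine Finset.sum_congr rfl fun n _ => ?_
    rw [Nat.factorial_succ]
    have : (n.factorial : ℝ) ≠ 0 := by exact_mod_cast n.factorial_ne_zero
    push_cast
    field_simp
  rw [e]
  refine h.congr_fun fun m => ?_
  rw [Finset.mul_sum]
  exact Finset.sum_congr rfl fun n _ => by ring

theorem hasSum_stirlingS_part (q N : ℕ) (hN : q + 2 ≤ N) :
    HasSum (fun m : ℕ => logPowCoeff (q + 1) (m + 1) *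
        (if m + 1 < N then (m.factorial : ℝ) / (N : ℝ) ^ (m + 1) else 0))
      (((∑ n ∈ Finset.range (N + 1 - (q + 2)),
        (-1) ^ n * stirlingS (n + (q + 2) - 1) (q + 2 - 1) /
        (((n + (q + 2) - 1 : ℕ) : ℚ) * (N : ℚ) ^ (n + (q + 2) - 1)) : ℚ)) : ℝ) := by
  obtain ⟨M, rfl⟩ := Nat.exists_eq_add_of_le' hN
  set f := fun m : ℕ => logPowCoeff (q + 1) (m + 1) *
    (if m + 1 < M + (q + 2) then
      (m.factorial : ℝ) / ((M + (q + 2) : ℕ) : ℝ) ^ (m + 1) else 0) with hf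
  have h := hasSum_sum_of_ne_finset_zero (L := .unconditional ℕ) (f := f) (s := Finset.range (q + (M + 1))) (by
    intro m hm
    rw [Finset.mem_range] at hm
    simp only [hf]
    rw [if_neg (by omega), mul_zero])
  -- The coefficients vanish for `m < q`, so the summation index becomes `m = q + n`.
  rw [Finset.sum_range_add, Finset.sum_eq_zero (fun m hm => by
    rw [Finset.mem_range] at hm
    simp only [hf]
    rw [logPowCoeff_of_lt (by omega), zero_mul]), zero_add] at h
  convert h using 1
  rw [show M + (q + 2) + 1 - (q + 2) = M + 1 by omega]
  push_cast
  refine Finset.sum_congr rfl fun n hn => ?_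
  rw [Finset.mem_range] at hn
  simp only [hf]
  rw [if_pos (by omega), show n + (q + 2) - 1 = q + n + 1 by omega, stirlingS_eq, logPowCoeff, Nat.factorial_succ]
  have h1 : (((q + n).factorial : ℕ) : ℝ) ≠ 0 := by exact_mod_cast Nat.factorial_ne_zero _
  have h2 : (-1 : ℝ) ^ n * (-1) ^ (q + n + 1 + (q + 1)) = 1 := by
    rw [← pow_add]
    exact Even.neg_one_pow ⟨n + q + 1, by ring⟩
  push_cast
  rw [← mul_assoc, h2, one_mul]
  field_simp

theorem abs_zeta_sub_zetaApprox_le (q N : ℕ) (hN : q + 2 ≤ N) :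
    |(∑' n : ℕ, 1 / ((n : ℝ) + 1) ^ (q + 2)) - (zetaApprox (q + 2) N : ℝ)| ≤
      3 * (∑' n : ℕ, 1 / ((n : ℝ) + 1) ^ (q + 2)) * N * Real.exp (-(N : ℝ)) := by
  have hz := hasSum_logPowCoeff_div q
  have h := (hz.sub (hasSum_genStirling_part q N)).sub (hasSum_stirlingS_part q N hN)
  rw [sub_sub, ← Rat.cast_add, ← zetaApprox] at h
  rw [← h.tsum_eq, ← Real.norm_eq_abs]
  refine (tsum_of_norm_bounded (hz.mul_left (3 * N * Real.exp (-(N : ℝ)))) fun m => ?_).trans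
    (le_of_eq (by ring))
  rw [div_eq_mul_one_div, ← mul_sub, ← mul_sub, norm_mul, Real.norm_eq_abs, Real.norm_eq_abs,
    abs_of_nonneg (logPowCoeff_nonneg _ _)]
  refine (mul_le_mul_of_nonneg_left (abs_error_coeff_le (by omega) m)
    (logPowCoeff_nonneg _ _)).trans (le_of_eq (by ring))

theorem riemannZeta_eq_ofReal_tsum (q : ℕ) :
    riemannZeta ((q + 2 : ℕ) : ℂ) = ((∑' n : ℕ, 1 / ((n : ℝ) + 1) ^ (q + 2) : ℝ) : ℂ) := by
  rw [zeta_eq_tsum_one_div_nat_add_one_cpow (by simp; norm_cast; omega)]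
  push_cast
  refine tsum_congr fun n => ?_
  rw [← Complex.cpow_natCast]
  push_cast
  rfl

end ZetaApprox

theorem mainTheorem1 (p : ℕ) (hp : 2 ≤ p) :
    ∃ C : ℝ, 0 < C ∧ ∀ᶠ N : ℕ in Filter.atTop,
      ‖riemannZeta (p : ℂ) - ((ZetaApprox.zetaApprox p N : ℚ) : ℂ)‖ ≤
        C * (N : ℝ) * Real.exp (-(N : ℝ)) := by
  obtain ⟨q, rfl⟩ := Nat.exists_eq_add_of_le' hp
  have hz : Summable fun n : ℕ => 1 / ((n : ℝ) + 1) ^ (q + 2) := by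
    simpa using (summable_nat_add_iff 1).mpr
      (Real.summable_one_div_nat_pow.mpr (by omega : 1 < q + 2))
  have hpos : 0 < ∑' n : ℕ, 1 / ((n : ℝ) + 1) ^ (q + 2) :=
    hz.tsum_pos (fun n => by positivity) 0 (by positivity)
  refine ⟨_, mul_pos three_pos hpos, ?_⟩
  filter_upwards [Filter.eventually_ge_atTop (q + 2)] with N hN
  rw [ZetaApprox.riemannZeta_eq_ofReal_tsum, ← Complex.ofReal_ratCast, ← Complex.ofReal_sub,
    Complex.norm_real, Real.norm_eq_abs]
  exact ZetaApprox.abs_zeta_sub_zetaApprox_le q N hN
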